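/- Let $A=C^{\infty}(\mathbb R^3)$ be the algebra of real-valued smooth functions. For an $\mathbb R$-linear map $\gamma:A\to A$ and an $\mathbb R$-bilinear map $F:A\times A\to A$ write $$(\delta\gamma)(a,b)=a\gamma(b)-\gamma(ab)+\gamma(a)b,$$ $$(\delta F)(a,b,c)=aF(b,c)-F(ab,c)+F(a,bc)-F(a,b)c,$$ $$(F\circ F)(a,b,c)=F(F(a,b),c)-F(a,F(b,c)).$$ A differential 1-cochain is a finite sum of maps $a\,\partial_{i_1}\cdots\partial_{i_r}$ with $a\in A$, $r\ge 0$; a differential 2-cochain is a finite sum of maps $(a,b)\mapsto f(a)g(b)$ with $f,g$ differential 1-cochains. An infinitesimal deformation of $A$ is an $\mathbb R$-bilinear $F_1:A\times A\to A$ with $\delta F_1=0$ that represents a class of the differential Hochschild cohomology of $A$, i.e. such that $F_1-\delta\gamma$ is a differential 2-cochain for some $\mathbb R$-linear $\gamma:A\to A$. Its primary obstruction vanishes if $F_1\circ F_1=\delta G$ for some $\mathbb R$-bilinear $G:A\times A\to A$. Let $\varphi\in A$. (i) If $F_1$ is an infinitesimal deformation of $A$ whose primary obstruction vanishes, then $\varphi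 F_1$ is an infinitesimal deformation of $A$ whose primary obstruction vanishes. (ii) The same holds within the differential subcomplex: if $F_1$ is a differential 2-cocycle and $F_1\circ F_1=\delta G$ for some differential 2-cochain $G$, then $\varphi F_1$ is a differential 2-cocycle and $(\varphi F_1)\circ(\varphi F_1)=\delta G'$ for some differential 2-cochain $G'$. (iii) In particular, if a skew biderivation $F_1$ of $A$ is Poisson, i.e. satisfies the Jacobi identity $F_1(a,F_1(b,c))+F_1(b,F_1(c,a))+F_1(c,F_1(a,b))=0$ for all $a,b,c\in A$, then $\varphi F_1$ is again a Poisson skew biderivation. -/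

import Mathlib

open scoped ContDiff Manifold

noncomputable section

/-! ## Low-degree Hochschild cochains of a commutative algebra, with coefficients in itself -/

section Hochschild

variable {k A : Type*} [CommRing k] [CommRing A] [Algebra k A]

/-- The cup product `f ⌣ g` of two 1-cochains: `(f ⌣ g)(a, b) = f a * g b`. -/
def cupProd (f g : A →ₗ[k] A) : A →ₗ[k] A →ₗ[k] A :=
  (LinearMap.mul k A).compl₁₂ f g

/-- The multiple `φ F` of a 2-cochain by an element of the algebra:
`(φ F)(a, b) = φ * F(a, b)`. -/
def scaleCochain (φ : A) (F : A →ₗ[k] A →ₗ[k] A) : A →ₗ[k] A →ₗ[k] A :=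
  F.compr₂ (LinearMap.mulLeft k φ)

/-- The Hochschild coboundary of a 1-cochain: `(δγ)(a, b) = a γ(b) - γ(ab) + γ(a) b`. -/
def coboundaryOne (γ : A →ₗ[k] A) : A →ₗ[k] A →ₗ[k] A :=
  cupProd LinearMap.id γ - (LinearMap.mul k A).compr₂ γ + cupProd γ LinearMap.id

/-- The Hochschild coboundary of a 2-cochain:
`(δF)(a, b, c) = a F(b, c) - F(ab, c) + F(a, bc) - F(a, b) c`. -/
def coboundaryTwo (F : A →ₗ[k] A →ₗ[k] A) (a b c : A) : A :=
  a * F b c - F (a * b) c + F a (b * c) - F a b * c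

/-- The composition product of 2-cochains:
`(F ∘ G)(a, b, c) = F(G(a, b), c) - F(a, G(b, c))`. -/
def compProd (F G : A →ₗ[k] A →ₗ[k] A) (a b c : A) : A :=
  F (G a b) c - F a (G b c)

/-- Hochschild 2-cocycles. -/
def IsTwoCocycle (F : A →ₗ[k] A →ₗ[k] A) : Prop :=
  ∀ a b c, coboundaryTwo F a b c = 0

/-- The primary obstruction of `F`, that is, the class of `F ∘ F` in `H³(A, A)`, vanishes:
`F ∘ F` is the coboundary of a 2-cochain. -/
def PrimaryObstructionVanishes (F : A →ₗ[k] A →ₗ[k] A) : Prop :=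
  ∃ G : A →ₗ[k] A →ₗ[k] A, ∀ a b c, compProd F F a b c = coboundaryTwo G a b c

/-- Skew 2-cochains. -/
def IsSkew (F : A →ₗ[k] A →ₗ[k] A) : Prop :=
  ∀ a b, F a b = -F b a

/-- Biderivations. -/
def IsBiderivation (F : A →ₗ[k] A →ₗ[k] A) : Prop :=
  (∀ a b c, F (a * b) c = a * F b c + b * F a c) ∧
    ∀ a b c, F a (b * c) = b * F a c + c * F a b

/-- Poisson structures: skew biderivations that satisfy the Jacobi identity. -/
def IsPoisson (F : A →ₗ[k] A →ₗ[k] A) : Prop :=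
  IsSkew F ∧ IsBiderivation F ∧
    ∀ a b c, F a (F b c) + F b (F c a) + F c (F a b) = 0

end Hochschild

/-! ## The algebra of smooth functions and its differential cochains -/

/-- The real algebra `C^∞(ℝ^d)` of smooth real-valued functions on `ℝ^d`. -/
abbrev SmoothFun (d : ℕ) : Type :=
  C^∞⟮𝓘(ℝ, EuclideanSpace ℝ (Fin d)), EuclideanSpace ℝ (Fin d); 𝓘(ℝ, ℝ), ℝ⟯

/-- The partial derivative `∂ᵢ` as an `ℝ`-linear endomorphism of `C^∞(ℝ^d)`. -/
def partialDeriv {d : ℕ} (i : Fin d) : SmoothFun d →ₗ[ℝ] SmoothFun d where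
  toFun f :=
    ⟨fun x => fderiv ℝ f x (EuclideanSpace.single i 1),
      ((f.contMDiff.contDiff.fderiv_right (m := ∞) le_rfl).clm_apply contDiff_const).contMDiff⟩
  map_add' f g := by
    ext x
    have hf : DifferentiableAt ℝ f x := (f.contMDiff.contDiff.differentiable (by simp)) x
    have hg : DifferentiableAt ℝ g x := (g.contMDiff.contDiff.differentiable (by simp)) x
    change fderiv ℝ (⇑f + ⇑g) x _ = fderiv ℝ f x _ + fderiv ℝ g x _
    rw [fderiv_add hf hg]
    rfl
  map_smul' r f := by
    ext x
    have hf : DifferentiableAt ℝ f x := (f.contMDiff.contDiff.differentiable (by simp)) x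
    change fderiv ℝ (r • ⇑f) x _ = r • fderiv ℝ f x _
    rw [fderiv_const_smul hf]
    rfl

/-- The iterated partial derivative `∂_{i₁} ∂_{i₂} ⋯ ∂_{iᵣ}` for `I = [i₁, …, iᵣ]`
(the identity for `I = []`). -/
def iterPartial {d : ℕ} (I : List (Fin d)) : SmoothFun d →ₗ[ℝ] SmoothFun d :=
  I.foldr (fun i D => partialDeriv i ∘ₗ D) LinearMap.id

/-- Differential 1-cochains: finite sums of cochains `a ∂_{i₁} ⋯ ∂_{iᵣ}`, with `a` smooth. -/
def diffOneCochains (d : ℕ) : Submodule ℝ (SmoothFun d →ₗ[ℝ] SmoothFun d) :=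
  Submodule.span ℝ
    {γ | ∃ (a : SmoothFun d) (I : List (Fin d)), γ = LinearMap.mulLeft ℝ a ∘ₗ iterPartial I}

/-- Differential 2-cochains: finite sums of cup products of differential 1-cochains. -/
def diffTwoCochains (d : ℕ) : Submodule ℝ (SmoothFun d →ₗ[ℝ] SmoothFun d →ₗ[ℝ] SmoothFun d) :=
  Submodule.span ℝ
    {F | ∃ f ∈ diffOneCochains d, ∃ g ∈ diffOneCochains d, F = cupProd f g}

/-- An infinitesimal deformation of `C^∞(ℝ^d)`: a Hochschild 2-cocycle (an arbitrary bilinear one)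
that represents a class of the differential Hochschild cohomology, that is, which is cohomologous
to a differential cocycle. Every differential cocycle is one (take `γ = 0`). -/
def IsInfinitesimalDeformation {d : ℕ} (F : SmoothFun d →ₗ[ℝ] SmoothFun d →ₗ[ℝ] SmoothFun d) :
    Prop :=
  IsTwoCocycle F ∧
    ∃ γ : SmoothFun d →ₗ[ℝ] SmoothFun d, F - coboundaryOne γ ∈ diffTwoCochains d

/-- The primary obstruction of `F` vanishes within the differential subcomplex: `F ∘ F` is the
coboundary of a differential 2-cochain. -/
def DiffPrimaryObstructionVanishes {d : ℕ}
    (F : SmoothFun d →ₗ[ℝ] SmoothFun d →ₗ[ℝ] SmoothFun d) : Prop :=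
  ∃ G ∈ diffTwoCochains d, ∀ a b c, compProd F F a b c = coboundaryTwo G a b c

end

/-!
A differential 2-cocycle `F` is `P + δγ`, where `P` is its skew part, a biderivation, and `γ` is a
differential 1-cochain (the Hochschild–Kostant–Rosenberg theorem in degree two). Indeed, the symbol
of the symmetric differential cocycle `F - P`, read off from its values on exponentials, is a
symmetric polynomial 2-cocycle of the additive group `ℝ^d`. Its component of degree `n ≠ 1` is the
coboundary of `(2 - 2 ^ n)⁻¹` times its restriction to the diagonal, and its component of degree `1`
is zero.

Replacing `F` by `F + δγ` changes `F ∘ F` by a coboundary, so the obstruction of `F` is that of `P`.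
It vanishes if and only if `P` is Poisson: the alternating sum of `P ∘ P` is a multiple of the
Jacobiator, and in the other direction `P ∘ P` is the coboundary of the second-order term of
Kontsevich's star product. Finally, the Jacobiator of `φ P` is `φ ^ 2` times that of `P` plus `φ`
times a value of the 4-vector field `P ∧ P`, which is zero in dimension three.
-/

section Hochschild

variable {k A : Type*} [CommRing k] [CommRing A] [Algebra k A]

@[simp]
lemma cupProd_apply (f g : A →ₗ[k] A) (a b : A) : cupProd f g a b = f a * g b := rfl

@[simp]
lemma scaleCochain_apply (φ : A) (F : A →ₗ[k] A →ₗ[k] A) (a b : A) :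
    scaleCochain φ F a b = φ * F a b := rfl

lemma coboundaryOne_apply (γ : A →ₗ[k] A) (a b : A) :
    coboundaryOne γ a b = a * γ b - γ (a * b) + γ a * b := rfl

lemma coboundaryOne_neg (γ : A →ₗ[k] A) : coboundaryOne (-γ) = -coboundaryOne γ := by
  ext a b
  simp only [coboundaryOne_apply, LinearMap.neg_apply]
  ring

lemma coboundaryTwo_add (F G : A →ₗ[k] A →ₗ[k] A) (a b c : A) :
    coboundaryTwo (F + G) a b c = coboundaryTwo F a b c + coboundaryTwo G a b c := by
  simp only [coboundaryTwo, LinearMap.add_apply]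
  ring

lemma coboundaryTwo_smul (r : k) (F : A →ₗ[k] A →ₗ[k] A) (a b c : A) :
    coboundaryTwo (r • F) a b c = r • coboundaryTwo F a b c := by
  simp only [coboundaryTwo, LinearMap.smul_apply, mul_smul_comm, smul_mul_assoc, smul_sub,
    smul_add]

lemma coboundaryTwo_sum {ι : Type*} (s : Finset ι) (F : ι → A →ₗ[k] A →ₗ[k] A) (a b c : A) :
    coboundaryTwo (∑ i ∈ s, F i) a b c = ∑ i ∈ s, coboundaryTwo (F i) a b c := by
  simp only [coboundaryTwo, LinearMap.sum_apply, Finset.mul_sum, Finset.sum_mul,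
    Finset.sum_sub_distrib, Finset.sum_add_distrib]

lemma coboundaryTwo_cupProd (f g : A →ₗ[k] A) (a b c : A) :
    coboundaryTwo (cupProd f g) a b c =
      coboundaryOne f a b * g c - f a * coboundaryOne g b c := by
  simp only [coboundaryTwo, coboundaryOne_apply, cupProd_apply]
  ring

lemma coboundaryOne_derivation (X : Derivation k A A) (a b : A) :
    coboundaryOne (X : A →ₗ[k] A) a b = 0 := by
  simp only [coboundaryOne_apply, Derivation.coeFn_coe, Derivation.leibniz, smul_eq_mul]
  ring

lemma coboundaryOne_derivation_comp (X Y : Derivation k A A) (a b : A) :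
    coboundaryOne ((X : A →ₗ[k] A) ∘ₗ (Y : A →ₗ[k] A)) a b = -(X a * Y b + Y a * X b) := by
  simp only [coboundaryOne_apply, LinearMap.comp_apply, Derivation.coeFn_coe, Derivation.leibniz,
    map_add, smul_eq_mul]
  ring

lemma isTwoCocycle_coboundaryOne (γ : A →ₗ[k] A) : IsTwoCocycle (coboundaryOne γ) := by
  intro a b c
  simp only [coboundaryTwo, coboundaryOne_apply, mul_assoc]
  ring

lemma IsTwoCocycle.sub {F G : A →ₗ[k] A →ₗ[k] A} (hF : IsTwoCocycle F) (hG : IsTwoCocycle G) :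
    IsTwoCocycle (F - G) := by
  intro a b c
  have hFabc := hF a b c
  have hGabc := hG a b c
  simp only [coboundaryTwo, LinearMap.sub_apply] at *
  linear_combination hFabc - hGabc

lemma IsTwoCocycle.scaleCochain {F : A →ₗ[k] A →ₗ[k] A} (hF : IsTwoCocycle F) (φ : A) :
    IsTwoCocycle (scaleCochain φ F) := by
  intro a b c
  have hFabc := hF a b c
  simp only [coboundaryTwo, scaleCochain_apply] at *
  linear_combination φ * hFabc

lemma IsBiderivation.isTwoCocycle {P : A →ₗ[k] A →ₗ[k] A} (hP : IsBiderivation P) :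
    IsTwoCocycle P := by
  intro a b c
  simp only [coboundaryTwo, hP.1, hP.2]
  ring

lemma scaleCochain_add (φ : A) (F G : A →ₗ[k] A →ₗ[k] A) :
    scaleCochain φ (F + G) = scaleCochain φ F + scaleCochain φ G := by
  ext a b
  simp only [scaleCochain_apply, LinearMap.add_apply, mul_add]

lemma scaleCochain_sub (φ : A) (F G : A →ₗ[k] A →ₗ[k] A) :
    scaleCochain φ (F - G) = scaleCochain φ F - scaleCochain φ G := by
  ext a b
  simp only [scaleCochain_apply, LinearMap.sub_apply, mul_sub]

lemma scaleCochain_coboundaryOne (φ : A) (γ : A →ₗ[k] A) :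
    scaleCochain φ (coboundaryOne γ) = coboundaryOne (LinearMap.mulLeft k φ ∘ₗ γ) := by
  ext a b
  simp only [coboundaryOne_apply, scaleCochain_apply, LinearMap.comp_apply,
    LinearMap.mulLeft_apply]
  ring

/-- The 2-cochain by whose coboundary `F ∘ F` changes when the cocycle `F` is replaced by
`F + δγ`. It is the second-order term of the multiplication `a b + t F(a, b)` transported along
the gauge transformation `id + t γ`. -/
def gaugeCorrection (F : A →ₗ[k] A →ₗ[k] A) (γ : A →ₗ[k] A) : A →ₗ[k] A →ₗ[k] A :=
  cupProd γ γ + F.compl₁₂ γ LinearMap.id + F.compl₁₂ LinearMap.id γ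
    - (cupProd γ LinearMap.id + cupProd LinearMap.id γ + F).compr₂ γ
    + (LinearMap.mul k A).compr₂ (γ ∘ₗ γ)

lemma gaugeCorrection_apply (F : A →ₗ[k] A →ₗ[k] A) (γ : A →ₗ[k] A) (a b : A) :
    gaugeCorrection F γ a b =
      γ a * γ b + F (γ a) b + F a (γ b) - γ (γ a * b + a * γ b + F a b) + γ (γ (a * b)) := rfl

lemma compProd_add_coboundaryOne {F : A →ₗ[k] A →ₗ[k] A} (hF : IsTwoCocycle F) (γ : A →ₗ[k] A)
    (a b c : A) :
    compProd (F + coboundaryOne γ) (F + coboundaryOne γ) a b c =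
      compProd F F a b c + coboundaryTwo (gaugeCorrection F γ) a b c := by
  have h₁ := hF (γ a) b c
  have h₂ := hF a (γ b) c
  have h₃ := hF a b (γ c)
  have h₄ := congrArg γ (hF a b c)
  simp only [coboundaryTwo, compProd, gaugeCorrection_apply, coboundaryOne_apply,
    LinearMap.add_apply, LinearMap.sub_apply, map_add, map_sub, map_zero, add_mul, mul_add,
    sub_mul, mul_sub, mul_assoc] at *
  linear_combination -h₁ - h₂ - h₃ + h₄

lemma PrimaryObstructionVanishes.add_coboundaryOne {F : A →ₗ[k] A →ₗ[k] A}
    (h : PrimaryObstructionVanishes F) (hF : IsTwoCocycle F) (γ : A →ₗ[k] A) :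
    PrimaryObstructionVanishes (F + coboundaryOne γ) := by
  obtain ⟨G, hG⟩ := h
  exact ⟨G + gaugeCorrection F γ, fun a b c => by
    rw [compProd_add_coboundaryOne hF, hG, coboundaryTwo_add]⟩

lemma PrimaryObstructionVanishes.sub_coboundaryOne {F : A →ₗ[k] A →ₗ[k] A}
    (h : PrimaryObstructionVanishes F) (hF : IsTwoCocycle F) (γ : A →ₗ[k] A) :
    PrimaryObstructionVanishes (F - coboundaryOne γ) := by
  have hsub : F - coboundaryOne γ = F + coboundaryOne (-γ) := by
    rw [coboundaryOne_neg]
    exact sub_eq_add_neg F (coboundaryOne γ)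
  exact hsub ▸ h.add_coboundaryOne hF (-γ)

end Hochschild

section Skew

variable {k A : Type*} [CommRing k] [CommRing A] [Algebra k A] {P : A →ₗ[k] A →ₗ[k] A}

/-- The Jacobiator of a 2-cochain, whose vanishing is the Jacobi identity. -/
def jacobiator (P : A →ₗ[k] A →ₗ[k] A) (a b c : A) : A :=
  P a (P b c) + P b (P c a) + P c (P a b)

lemma IsSkew.scaleCochain (hP : IsSkew P) (φ : A) : IsSkew (scaleCochain φ P) := by
  intro a b
  rw [scaleCochain_apply, scaleCochain_apply, hP a b, mul_neg]

lemma IsBiderivation.scaleCochain (hP : IsBiderivation P) (φ : A) :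
    IsBiderivation (scaleCochain φ P) := by
  refine ⟨fun a b c => ?_, fun a b c => ?_⟩
  · simp only [scaleCochain_apply, hP.1]
    ring
  · simp only [scaleCochain_apply, hP.2]
    ring

lemma IsSkew.isBiderivation (hP : IsSkew P)
    (h : ∀ a b c, P (a * b) c = a * P b c + b * P a c) : IsBiderivation P := by
  refine ⟨h, fun a b c => ?_⟩
  rw [hP a, hP a, hP a, h]
  ring

lemma coboundaryTwo_alternating_sum (G : A →ₗ[k] A →ₗ[k] A) (a b c : A) :
    coboundaryTwo G a b c + coboundaryTwo G b c a + coboundaryTwo G c a b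
      - coboundaryTwo G b a c - coboundaryTwo G a c b - coboundaryTwo G c b a = 0 := by
  simp only [coboundaryTwo, mul_comm b a, mul_comm c b, mul_comm c a]
  ring

lemma IsSkew.jacobiator_swap (hP : IsSkew P) (a b c : A) :
    jacobiator P b a c = -jacobiator P a b c := by
  simp only [jacobiator, hP b a, hP c b, hP c a, map_neg]
  ring

lemma IsSkew.compProd_self_cyclic_sum (hP : IsSkew P) (a b c : A) :
    compProd P P a b c + compProd P P b c a + compProd P P c a b = -2 * jacobiator P a b c := by
  simp only [compProd, jacobiator, hP (P _ _) _]
  ring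

lemma IsSkew.four_mul_jacobiator (hP : IsSkew P) (h : PrimaryObstructionVanishes P) (a b c : A) :
    4 * jacobiator P a b c = 0 := by
  obtain ⟨G, hG⟩ := h
  have hG_alt := coboundaryTwo_alternating_sum G a b c
  simp only [← hG] at hG_alt
  linear_combination -hG_alt + hP.compProd_self_cyclic_sum a b c
    - hP.compProd_self_cyclic_sum b a c + 2 * hP.jacobiator_swap a b c

end Skew

section SkewPart

lemma isUnit_two_of_algebra (k A : Type*) [Semifield k] [NeZero (2 : k)] [Semiring A]
    [Algebra k A] : IsUnit (2 : A) := by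
  simpa only [map_ofNat] using (two_ne_zero (α := k)).isUnit.map (algebraMap k A)

variable {k A : Type*} [Field k] [CommRing A] [Algebra k A]

/-- The skew part of a 2-cochain. -/
def skewPart (F : A →ₗ[k] A →ₗ[k] A) : A →ₗ[k] A →ₗ[k] A :=
  (2⁻¹ : k) • (F - F.flip)

lemma skewPart_apply (F : A →ₗ[k] A →ₗ[k] A) (a b : A) :
    skewPart F a b = (2⁻¹ : k) • (F a b - F b a) := rfl

lemma isSkew_skewPart (F : A →ₗ[k] A →ₗ[k] A) : IsSkew (skewPart F) := by
  intro a b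
  rw [skewPart_apply, skewPart_apply, ← smul_neg, neg_sub]

variable [NeZero (2 : k)]

lemma two_mul_skewPart_apply (F : A →ₗ[k] A →ₗ[k] A) (a b : A) :
    2 * skewPart F a b = F a b - F b a := by
  rw [skewPart_apply, two_mul, ← two_smul k, smul_inv_smul₀ two_ne_zero]

lemma IsSkew.apply_self {P : A →ₗ[k] A →ₗ[k] A} (hP : IsSkew P) (a : A) : P a a = 0 := by
  apply (isUnit_two_of_algebra k A).mul_left_cancel
  linear_combination hP a a

lemma IsTwoCocycle.isBiderivation_skewPart {F : A →ₗ[k] A →ₗ[k] A} (hF : IsTwoCocycle F) :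
    IsBiderivation (skewPart F) := by
  refine (isSkew_skewPart F).isBiderivation fun a b c => ?_
  apply (isUnit_two_of_algebra k A).mul_left_cancel
  have h₁ := hF a b c
  have h₂ := hF a c b
  have h₃ := hF c a b
  simp only [coboundaryTwo, mul_comm c] at h₁ h₂ h₃
  linear_combination two_mul_skewPart_apply F (a * b) c - a * two_mul_skewPart_apply F b c
    - b * two_mul_skewPart_apply F a c - h₁ + h₂ - h₃

lemma IsBiderivation.isPoisson {P : A →ₗ[k] A →ₗ[k] A} (hP : IsBiderivation P) (hs : IsSkew P)
    (h : PrimaryObstructionVanishes P) : IsPoisson P := by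
  refine ⟨hs, hP, fun a b c => ?_⟩
  have h₂ : IsUnit (2 : A) := isUnit_two_of_algebra k A
  apply (h₂.mul h₂).mul_left_cancel
  linear_combination (norm := (simp only [jacobiator]; ring)) hs.four_mul_jacobiator h a b c

end SkewPart

section Pluecker

variable {k A : Type*} [CommRing k] [CommRing A] [Algebra k A] {P : A →ₗ[k] A →ₗ[k] A}

/-- The quadratic Plücker expression of a skew biderivation `P`. Up to a constant factor it is the
4-vector field `P ∧ P`, evaluated on `a`, `b`, `c`, `e`. -/
def pluckerForm (P : A →ₗ[k] A →ₗ[k] A) (a b c e : A) : A :=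
  P a e * P b c + P b e * P c a + P c e * P a b

lemma jacobiator_scaleCochain (hP : IsBiderivation P) (φ a b c : A) :
    jacobiator (scaleCochain φ P) a b c =
      φ ^ 2 * jacobiator P a b c + φ * pluckerForm P a b c φ := by
  simp only [jacobiator, pluckerForm, scaleCochain_apply, hP.2]
  ring

lemma IsPoisson.scaleCochain_of_pluckerForm_eq_zero (hP : IsPoisson P) {φ : A}
    (hφ : ∀ a b c, pluckerForm P a b c φ = 0) : IsPoisson (scaleCochain φ P) := by
  refine ⟨hP.1.scaleCochain φ, hP.2.1.scaleCochain φ, fun a b c => ?_⟩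
  have hJ : jacobiator P a b c = 0 := hP.2.2 a b c
  have h := jacobiator_scaleCochain hP.2.1 φ a b c
  rwa [hJ, hφ, mul_zero, mul_zero, add_zero] at h

lemma IsSkew.pluckerForm_rotate (hP : IsSkew P) (a b c e : A) :
    pluckerForm P b c e a = -pluckerForm P a b c e := by
  simp only [pluckerForm, hP b a, hP c a, hP e a, hP e b]
  ring

lemma IsSkew.pluckerForm_eq_zero {k A : Type*} [Field k] [NeZero (2 : k)] [CommRing A]
    [Algebra k A] {P : A →ₗ[k] A →ₗ[k] A} (hP : IsSkew P) {a b c e : A}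
    (h : a = b ∨ a = c ∨ a = e ∨ b = c ∨ b = e ∨ c = e) : pluckerForm P a b c e = 0 := by
  have hab := hP a b
  have hbc := hP b c
  have hac := hP c a
  rcases h with rfl | rfl | rfl | rfl | rfl | rfl <;>
    simp only [pluckerForm, hP.apply_self] <;> grind

end Pluecker

section Star

variable {k A ι : Type*} [CommRing k] [CommRing A] [Algebra k A] {P : A →ₗ[k] A →ₗ[k] A}

/-- The Hamiltonian derivation `P(a, ·)` of `a`. -/
def IsBiderivation.hamiltonian (hP : IsBiderivation P) (a : A) : Derivation k A A :=
  Derivation.mk' (P a) fun b c => hP.2 a b c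

lemma IsBiderivation.hamiltonian_apply (hP : IsBiderivation P) (a b : A) :
    hP.hamiltonian a b = P a b := rfl

lemma IsPoisson.apply_apply (hP : IsPoisson P) (a b c : A) :
    P (P a b) c = P a (P b c) - P b (P a c) := by
  have h := hP.2.2 a b c
  rw [hP.1 c a, map_neg, hP.1 c (P a b)] at h
  linear_combination -h

/-- The contraction of the first derivatives of a Poisson structure `P` with `P`, which appears
when `P` is written `∑ j, D j ⌣ P(x j, ·)` with commuting derivations `D j`. -/
def contractedBracket [Fintype ι] (D : ι → Derivation k A A) (x : ι → A)
    (P : A →ₗ[k] A →ₗ[k] A) (a b c : A) : A :=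
  ∑ i, ∑ j, D i a * D j b * P (P (x i) (x j)) c

variable [Fintype ι] {D : ι → Derivation k A A} {x : ι → A}

lemma IsSkew.contractedBracket_swap (hP : IsSkew P) (a b c : A) :
    contractedBracket D x P b a c = -contractedBracket D x P a b c := by
  simp only [contractedBracket]
  rw [Finset.sum_comm, ← Finset.sum_neg_distrib]
  refine Finset.sum_congr rfl fun i _ => ?_
  rw [← Finset.sum_neg_distrib]
  refine Finset.sum_congr rfl fun j _ => ?_
  rw [hP (x j) (x i), map_neg, LinearMap.neg_apply]
  ring

lemma IsSkew.contractedBracket_eq_sum (hP : IsSkew P)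
    (hx : ∀ a b, P a b = ∑ j, D j a * P (x j) b) (a b c : A) :
    contractedBracket D x P a b c =
      -∑ i, ∑ j, ∑ l, D i a * D j b * D l c * P (x l) (P (x i) (x j)) := by
  simp only [contractedBracket, hP (P _ _) c, hx c, mul_neg, Finset.mul_sum,
    Finset.sum_neg_distrib, mul_assoc]

lemma IsPoisson.contractedBracket_cyclic_sum (hP : IsPoisson P)
    (hx : ∀ a b, P a b = ∑ j, D j a * P (x j) b) (a b c : A) :
    contractedBracket D x P a b c + contractedBracket D x P b c a
      + contractedBracket D x P c a b = 0 := by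
  have hbca : contractedBracket D x P b c a =
      -∑ i, ∑ j, ∑ l, D i a * D j b * D l c * P (x i) (P (x j) (x l)) := by
    rw [hP.1.contractedBracket_eq_sum hx, Finset.sum_comm_cycle]
    simp only [mul_comm, mul_left_comm]
  have hcab : contractedBracket D x P c a b =
      -∑ i, ∑ j, ∑ l, D i a * D j b * D l c * P (x j) (P (x l) (x i)) := by
    rw [hP.1.contractedBracket_eq_sum hx, ← Finset.sum_comm_cycle]
    simp only [mul_comm, mul_left_comm]
  rw [hbca, hcab, hP.1.contractedBracket_eq_sum hx]
  simp only [← neg_add, ← Finset.sum_add_distrib, ← mul_add]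
  refine neg_eq_zero.2 <| Finset.sum_eq_zero fun i _ => Finset.sum_eq_zero fun j _ =>
    Finset.sum_eq_zero fun l _ => ?_
  linear_combination D i a * D j b * D l c * hP.2.2 (x i) (x j) (x l)

/-- The second-order term of Kontsevich's star product of the Poisson structure
`∑ j, D j ⌣ P(x j, ·)`, with the coefficients `1/2`, `1/3`, `1/6` multiplied by `6`. -/
def kontsevichTerm (hP : IsPoisson P) (D : ι → Derivation k A A) (x : ι → A) :
    A →ₗ[k] A →ₗ[k] A :=
  let d (i : ι) : A →ₗ[k] A := D i
  let X (a : A) : A →ₗ[k] A := hP.2.1.hamiltonian a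
  ∑ i, ∑ j,
    ((3 : k) • cupProd (d i ∘ₗ d j) (X (x i) ∘ₗ X (x j))
      + (2 : k) • cupProd (d i) (X (P (x i) (x j)) ∘ₗ d j)
      + cupProd (X (P (x i) (x j)) ∘ₗ d i) (d j))

lemma coboundaryTwo_kontsevichTerm_eq_sum (hP : IsPoisson P) (a b c : A) :
    coboundaryTwo (kontsevichTerm hP D x) a b c = ∑ i, ∑ j,
      (3 * (D i (D j a) * (P (x i) b * P (x j) c + P (x j) b * P (x i) c)
        - (D i a * D j b + D j a * D i b) * P (x i) (P (x j) c))
      + 2 * (D i a * D j b * P (P (x i) (x j)) c + D i a * D j c * P (P (x i) (x j)) b)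
      - (D i a * D j c * P (P (x i) (x j)) b + D i b * D j c * P (P (x i) (x j)) a)) := by
  simp only [kontsevichTerm, coboundaryTwo_sum, coboundaryTwo_add, coboundaryTwo_smul,
    coboundaryTwo_cupProd, coboundaryOne_derivation_comp, coboundaryOne_derivation]
  refine Finset.sum_congr rfl fun i _ => Finset.sum_congr rfl fun j _ => ?_
  simp only [LinearMap.comp_apply, Derivation.coeFn_coe,
    IsBiderivation.hamiltonian_apply, Algebra.smul_def, map_ofNat]
  ring

lemma IsSkew.apply_eq_sum (hP : IsSkew P) (hx : ∀ a b, P a b = ∑ j, D j a * P (x j) b) (a b : A) :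
    P a b = ∑ j, D j b * P a (x j) := by
  rw [hP a b, hx b a, ← Finset.sum_neg_distrib]
  exact Finset.sum_congr rfl fun j _ => by rw [hP (x j) a, mul_neg, neg_neg]

lemma IsSkew.apply_hamiltonian_sub (hP : IsSkew P) (hD : ∀ i j a, D i (D j a) = D j (D i a))
    (hx : ∀ a b, P a b = ∑ j, D j a * P (x j) b) (j : ι) (a b : A) :
    D j (P a b) - P a (D j b) = ∑ m, D m b * D j (P a (x m)) := by
  rw [hP.apply_eq_sum hx a b, hP.apply_eq_sum hx a (D j b), map_sum, ← Finset.sum_sub_distrib]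
  refine Finset.sum_congr rfl fun m _ => ?_
  rw [Derivation.leibniz, smul_eq_mul, smul_eq_mul, hD j m b]
  ring

lemma IsSkew.sum_apply_hamiltonian_sub (hP : IsSkew P)
    (hD : ∀ i j a, D i (D j a) = D j (D i a)) (hx : ∀ a b, P a b = ∑ j, D j a * P (x j) b)
    (a b c : A) :
    ∑ j, (D j (P a b) - P a (D j b)) * P (x j) c = ∑ m, D m b * P (P a (x m)) c := by
  simp only [hP.apply_hamiltonian_sub hD hx, hx (P a _) c, Finset.sum_mul, Finset.mul_sum]
  rw [Finset.sum_comm]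
  simp only [mul_assoc]

lemma compProd_self_eq_sum (hP : IsPoisson P) (hD : ∀ i j a, D i (D j a) = D j (D i a))
    (hx : ∀ a b, P a b = ∑ j, D j a * P (x j) b) (a b c : A) :
    compProd P P a b c = (∑ i, ∑ j, (D i (D j a) * P (x i) b * P (x j) c
      - D i a * D j b * P (x i) (P (x j) c))) + contractedBracket D x P a b c := by
  have hleft : P (P a b) c =
      ∑ i, ∑ j, (D i (D j a) * P (x i) b + D i a * D j (P (x i) b)) * P (x j) c := by
    rw [hx (P a b) c, hx a b, Finset.sum_comm]
    simp only [map_sum, Derivation.leibniz, smul_eq_mul, Finset.sum_mul]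
    refine Finset.sum_congr rfl fun j _ => Finset.sum_congr rfl fun i _ => ?_
    rw [hD i j a]
    ring
  have hright : P a (P b c) =
      ∑ i, ∑ j, D i a * (D j b * P (x i) (P (x j) c) + P (x j) c * P (x i) (D j b)) := by
    rw [hx a (P b c), hx b c]
    simp only [map_sum, hP.2.1.2, Finset.mul_sum]
  have hbracket : contractedBracket D x P a b c =
      ∑ i, ∑ j, D i a * ((D j (P (x i) b) - P (x i) (D j b)) * P (x j) c) := by
    simp only [← Finset.mul_sum, hP.1.sum_apply_hamiltonian_sub hD hx]
    simp only [contractedBracket, Finset.mul_sum, mul_assoc]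
  rw [compProd, hleft, hright, hbracket]
  simp only [← Finset.sum_sub_distrib, ← Finset.sum_add_distrib]
  refine Finset.sum_congr rfl fun i _ => Finset.sum_congr rfl fun j _ => ?_
  ring

lemma IsPoisson.sum_symmetrized_eq (hP : IsPoisson P)
    (hD : ∀ i j a, D i (D j a) = D j (D i a)) (a b c : A) :
    ∑ i, ∑ j, (D i (D j a) * (P (x i) b * P (x j) c + P (x j) b * P (x i) c)
        - (D i a * D j b + D j a * D i b) * P (x i) (P (x j) c)) =
      2 * ∑ i, ∑ j, (D i (D j a) * P (x i) b * P (x j) c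
        - D i a * D j b * P (x i) (P (x j) c)) + contractedBracket D x P a b c := by
  have hleft : ∑ i, ∑ j, D i (D j a) * P (x j) b * P (x i) c =
      ∑ i, ∑ j, D i (D j a) * P (x i) b * P (x j) c := by
    rw [Finset.sum_comm]
    simp only [hD]
  have hright : ∑ i, ∑ j, D j a * D i b * P (x i) (P (x j) c) =
      ∑ i, ∑ j, D i a * D j b * P (x i) (P (x j) c) - contractedBracket D x P a b c := by
    rw [Finset.sum_comm]
    simp only [contractedBracket, hP.apply_apply, mul_sub, Finset.sum_sub_distrib]
    ring
  simp only [mul_add, add_mul, Finset.sum_sub_distrib, Finset.sum_add_distrib, ← mul_assoc, hleft,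
    hright]
  ring

lemma coboundaryTwo_kontsevichTerm (hP : IsPoisson P) (hD : ∀ i j a, D i (D j a) = D j (D i a))
    (hx : ∀ a b, P a b = ∑ j, D j a * P (x j) b) (a b c : A) :
    coboundaryTwo (kontsevichTerm hP D x) a b c = 6 * compProd P P a b c := by
  have hexpand : coboundaryTwo (kontsevichTerm hP D x) a b c =
      3 * ∑ i, ∑ j, (D i (D j a) * (P (x i) b * P (x j) c + P (x j) b * P (x i) c)
        - (D i a * D j b + D j a * D i b) * P (x i) (P (x j) c))
      + 2 * (contractedBracket D x P a b c + contractedBracket D x P a c b)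
      - (contractedBracket D x P a c b + contractedBracket D x P b c a) := by
    simp only [coboundaryTwo_kontsevichTerm_eq_sum, contractedBracket, Finset.mul_sum,
      ← Finset.sum_sub_distrib, ← Finset.sum_add_distrib]
  rw [hexpand, hP.sum_symmetrized_eq hD, compProd_self_eq_sum hP hD hx]
  linear_combination -hP.contractedBracket_cyclic_sum hx a b c
    + hP.1.contractedBracket_swap (D := D) (x := x) a c b

end Star

section ParametricIntegral

universe u

variable {E F : Type u} [NormedAddCommGroup E] [NormedSpace ℝ E] [ProperSpace E]
  [NormedAddCommGroup F] [NormedSpace ℝ F] {g : E × ℝ → F}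

lemma hasFDerivAt_intervalIntegral_of_contDiff (hg : ContDiff ℝ 1 g) (a b : ℝ) (x : E) :
    HasFDerivAt (fun x => ∫ t in a..b, g (x, t))
      (∫ t in a..b, (fderiv ℝ g (x, t)).comp (ContinuousLinearMap.inl ℝ E ℝ)) x := by
  have hg' : Continuous fun q : E × ℝ =>
      (fderiv ℝ g q).comp (ContinuousLinearMap.inl ℝ E ℝ) :=
    (hg.continuous_fderiv one_ne_zero).clm_comp continuous_const
  obtain ⟨C, hC⟩ := ((isCompact_closedBall x 1).prod
    (isCompact_uIcc (a := a) (b := b))).exists_bound_of_continuousOn hg'.continuousOn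
  have hslice (y : E) : Continuous fun t : ℝ => g (y, t) := hg.continuous.comp (by fun_prop)
  refine intervalIntegral.hasFDerivAt_integral_of_dominated_of_fderiv_le (𝕜 := ℝ)
    (F := fun x t => g (x, t)) (bound := fun _ => C)
    (F' := fun x t => (fderiv ℝ g (x, t)).comp (ContinuousLinearMap.inl ℝ E ℝ))
    (Metric.ball_mem_nhds x one_pos) (.of_forall fun y => (hslice y).aestronglyMeasurable)
    ((hslice x).intervalIntegrable _ _)
    (hg'.comp (by fun_prop : Continuous fun t : ℝ => (x, t))).aestronglyMeasurable
    (.of_forall fun t ht y hy => hC (y, t)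
      ⟨Metric.ball_subset_closedBall hy, Set.uIoc_subset_uIcc ht⟩)
    (continuous_const.intervalIntegrable _ _) (.of_forall fun t _ y _ => ?_)
  exact (hg.differentiable one_ne_zero (y, t)).hasFDerivAt.comp y (hasFDerivAt_prodMk_left y t)

lemma contDiff_intervalIntegral_of_contDiff {n : ℕ} (hg : ContDiff ℝ n g) (a b : ℝ) :
    ContDiff ℝ n (fun x => ∫ t in a..b, g (x, t)) := by
  induction n generalizing F with
  | zero =>
    exact contDiff_zero.2
      (intervalIntegral.continuous_parametric_intervalIntegral_of_continuous'
      (f := fun x t => g (x, t)) hg.continuous a b)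
  | succ n ih =>
    push_cast at hg ⊢
    refine (contDiff_succ_iff_hasFDerivAt (𝕜 := ℝ) (n := n)).2 ⟨_, ?_,
      hasFDerivAt_intervalIntegral_of_contDiff (hg.of_le (by simp)) a b⟩
    exact ih (g := fun q => (fderiv ℝ g q).comp (ContinuousLinearMap.inl ℝ E ℝ))
      ((hg.fderiv_right le_rfl).clm_comp contDiff_const)

end ParametricIntegral

section SmoothFun

variable {d : ℕ}

lemma SmoothFun.contDiff (f : SmoothFun d) : ContDiff ℝ ∞ f := f.contMDiff.contDiff

lemma SmoothFun.differentiableAt (f : SmoothFun d) (x : EuclideanSpace ℝ (Fin d)) :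
    DifferentiableAt ℝ f x := f.contDiff.differentiable (by simp) x

lemma SmoothFun.sum_apply {κ : Type*} (s : Finset κ) (f : κ → SmoothFun d)
    (x : EuclideanSpace ℝ (Fin d)) : (∑ i ∈ s, f i) x = ∑ i ∈ s, f i x :=
  map_sum (ContMDiffMap.evalRingHom x : SmoothFun d →+* ℝ) f s

lemma partialDeriv_mul (i : Fin d) (f g : SmoothFun d) :
    partialDeriv i (f * g) = f * partialDeriv i g + g * partialDeriv i f := by
  ext x
  change fderiv ℝ (⇑f * ⇑g) x _ = f x * fderiv ℝ g x _ + g x * fderiv ℝ f x _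
  rw [fderiv_mul (f.differentiableAt x) (g.differentiableAt x)]
  rfl

lemma partialDeriv_comm (i j : Fin d) (f : SmoothFun d) :
    partialDeriv i (partialDeriv j f) = partialDeriv j (partialDeriv i f) := by
  ext x
  have hf : DifferentiableAt ℝ (fderiv ℝ f) x :=
    (f.contDiff.fderiv_right (m := ∞) le_rfl).differentiable (by simp) x
  have hsecond (k l : Fin d) : partialDeriv k (partialDeriv l f) x =
      fderiv ℝ (fderiv ℝ f) x (EuclideanSpace.single k 1) (EuclideanSpace.single l 1) := by
    change fderiv ℝ (fun y => fderiv ℝ f y (EuclideanSpace.single l 1)) x _ = _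
    simp [fderiv_clm_apply hf (differentiableAt_const _)]
  rw [hsecond, hsecond]
  exact (f.contDiff.contDiffAt.isSymmSndFDerivAt
    (by simpa using WithTop.coe_le_coe.2 (le_top : (2 : ℕ∞) ≤ ⊤))) _ _

/-- The partial derivative `∂ᵢ` as a derivation. -/
noncomputable def partialDerivation (i : Fin d) : Derivation ℝ (SmoothFun d) (SmoothFun d) :=
  Derivation.mk' (partialDeriv i) (partialDeriv_mul i)

lemma partialDerivation_apply (i : Fin d) (f : SmoothFun d) :
    partialDerivation i f = partialDeriv i f := rfl

/-- The `i`-th coordinate function on `ℝ^d`. -/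
noncomputable def coordFun (i : Fin d) : SmoothFun d :=
  ⟨fun x => x i, (EuclideanSpace.proj (𝕜 := ℝ) i).contDiff.contMDiff⟩

lemma partialDeriv_coordFun (i j : Fin d) :
    partialDeriv i (coordFun j) = if i = j then 1 else 0 := by
  ext x
  change fderiv ℝ (EuclideanSpace.proj (𝕜 := ℝ) j) x _ = _
  rw [ContinuousLinearMap.fderiv]
  by_cases h : i = j
  · subst h
    simp
  · simp [h]

lemma SmoothFun.fderiv_apply (f : SmoothFun d) (x v : EuclideanSpace ℝ (Fin d)) :
    fderiv ℝ f x v = ∑ i, v i * partialDeriv i f x := by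
  have hv : v = ∑ i, v i • EuclideanSpace.single i (1 : ℝ) := by
    ext j
    simp [Pi.single_apply]
  conv_lhs => rw [hv, map_sum]
  simp only [map_smul, smul_eq_mul]
  rfl

lemma SmoothFun.sub_eq_sum_mul_integral (f : SmoothFun d) (x y : EuclideanSpace ℝ (Fin d)) :
    f y - f x = ∑ i, (y i - x i) * ∫ t in (0 : ℝ)..1, partialDeriv i f (x + t • (y - x)) := by
  have hcont (i : Fin d) : Continuous fun t : ℝ => partialDeriv i f (x + t • (y - x)) :=
    (partialDeriv i f).contMDiff.continuous.comp (by fun_prop)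
  have hderiv (t : ℝ) : HasDerivAt (fun t : ℝ => f (x + t • (y - x)))
      (∑ i, (y i - x i) * partialDeriv i f (x + t • (y - x))) t := by
    have hline : HasDerivAt (fun t : ℝ => x + t • (y - x)) (y - x) t := by
      simpa using ((hasDerivAt_id t).smul_const (y - x)).const_add x
    have hcomp := (f.differentiableAt (x + t • (y - x))).hasFDerivAt.comp_hasDerivAt t hline
    rwa [f.fderiv_apply] at hcomp
  have hint (i : Fin d) : IntervalIntegrable
      (fun t : ℝ => (y i - x i) * partialDeriv i f (x + t • (y - x))) MeasureTheory.volume 0 1 :=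
    (continuous_const.mul (hcont i)).intervalIntegrable _ _
  simp only [← intervalIntegral.integral_const_mul]
  rw [← intervalIntegral.integral_finsetSum fun i _ => hint i,
    intervalIntegral.integral_eq_sub_of_hasDerivAt (fun t _ => hderiv t)
      ((continuous_finsetSum _ fun i _ =>
        continuous_const.mul (hcont i)).intervalIntegrable _ _)]
  simp

lemma SmoothFun.exists_eq_add_sum (f : SmoothFun d) (x : EuclideanSpace ℝ (Fin d)) :
    ∃ g : Fin d → SmoothFun d,
      f = algebraMap ℝ _ (f x) + ∑ i, (coordFun i - algebraMap ℝ _ (x i)) * g i := by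
  have hsmooth (i : Fin d) : ContDiff ℝ ∞ fun q : EuclideanSpace ℝ (Fin d) × ℝ =>
      partialDeriv i f (x + q.2 • (q.1 - x)) :=
    (partialDeriv i f).contDiff.comp (by fun_prop)
  refine ⟨fun i => ⟨fun y => ∫ t in (0 : ℝ)..1, partialDeriv i f (x + t • (y - x)),
    (contDiff_infty.2 fun n => contDiff_intervalIntegral_of_contDiff
      (contDiff_infty.1 (hsmooth i) n) 0 1).contMDiff⟩, ?_⟩
  ext y
  refine eq_add_of_sub_eq' ((f.sub_eq_sum_mul_integral x y).trans ?_)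
  rw [SmoothFun.sum_apply]
  rfl

lemma SmoothFun.exists_derivation_apply_eq_sum (f : SmoothFun d) (x : EuclideanSpace ℝ (Fin d)) :
    ∃ v : Fin d → ℝ, ∀ δ : Derivation ℝ (SmoothFun d) (SmoothFun d),
      δ f x = ∑ i, v i * δ (coordFun i) x := by
  obtain ⟨g, hg⟩ := f.exists_eq_add_sum x
  refine ⟨fun i => g i x, fun δ => ?_⟩
  have hterm (i : Fin d) : δ ((coordFun i - algebraMap ℝ _ (x i)) * g i) x =
      g i x * δ (coordFun i) x := by
    rw [δ.leibniz, map_sub, δ.map_algebraMap, sub_zero]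
    change (x i - x i) * _ + g i x * _ = _
    ring
  conv_lhs => rw [hg, map_add, δ.map_algebraMap, zero_add, map_sum, SmoothFun.sum_apply]
  exact Finset.sum_congr rfl fun i _ => hterm i

lemma derivation_apply_eq_sum (δ : Derivation ℝ (SmoothFun d) (SmoothFun d)) (f : SmoothFun d) :
    δ f = ∑ i, partialDerivation i f * δ (coordFun i) := by
  ext x
  obtain ⟨v, hv⟩ := f.exists_derivation_apply_eq_sum x
  have hcoeff (i : Fin d) : v i = partialDerivation i f x := by
    rw [hv (partialDerivation i), Finset.sum_eq_single_of_mem i (Finset.mem_univ i)]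
    · simp [partialDerivation_apply, partialDeriv_coordFun]
    · intro j _ hj
      simp [partialDerivation_apply, partialDeriv_coordFun, hj.symm]
  rw [hv δ, SmoothFun.sum_apply]
  exact Finset.sum_congr rfl fun i _ => by rw [hcoeff]; rfl

variable {P : SmoothFun d →ₗ[ℝ] SmoothFun d →ₗ[ℝ] SmoothFun d}

lemma IsBiderivation.apply_eq_sum (hP : IsBiderivation P) (a b : SmoothFun d) :
    P a b = ∑ i, partialDerivation i a * P (coordFun i) b :=
  derivation_apply_eq_sum (Derivation.mk' (P.flip b) fun a a' => hP.1 a a' b) a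

lemma pluckerForm_eq_zero_of_coordFun (hP : IsBiderivation P) {b c e : SmoothFun d}
    (h : ∀ i, pluckerForm P (coordFun i) b c e = 0) (a : SmoothFun d) :
    pluckerForm P a b c e = 0 := by
  have hsum : pluckerForm P a b c e =
      ∑ i, partialDerivation i a * pluckerForm P (coordFun i) b c e := by
    have hright (u : SmoothFun d) : P u a = ∑ i, partialDerivation i a * P u (coordFun i) :=
      derivation_apply_eq_sum (hP.hamiltonian u) a
    simp only [pluckerForm, hP.apply_eq_sum a, hright, Finset.sum_mul, Finset.mul_sum,
      ← Finset.sum_add_distrib]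
    exact Finset.sum_congr rfl fun i _ => by ring
  simp [hsum, h]

lemma pluckerForm_eq_zero_of_le_three (hd : d ≤ 3) (hP : IsBiderivation P) (hs : IsSkew P)
    (a b c e : SmoothFun d) : pluckerForm P a b c e = 0 := by
  have hcoord (i j k l : Fin d) :
      pluckerForm P (coordFun i) (coordFun j) (coordFun k) (coordFun l) = 0 := by
    have hpigeon : i = j ∨ i = k ∨ i = l ∨ j = k ∨ j = l ∨ k = l := by omega
    exact hs.pluckerForm_eq_zero <| by
      rcases hpigeon with rfl | rfl | rfl | rfl | rfl | rfl <;> simp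
  have hrot {a b c e : SmoothFun d} (h : pluckerForm P a b c e = 0) :
      pluckerForm P b c e a = 0 := by
    rw [hs.pluckerForm_rotate, h, neg_zero]
  have h₁ (a) (j k l : Fin d) : pluckerForm P a (coordFun j) (coordFun k) (coordFun l) = 0 :=
    pluckerForm_eq_zero_of_coordFun hP (hcoord · j k l) a
  have h₂ (a b) (k l : Fin d) : pluckerForm P a (coordFun k) (coordFun l) b = 0 :=
    pluckerForm_eq_zero_of_coordFun hP (fun i => hrot (h₁ b i k l)) a
  have h₃ (a b c) (l : Fin d) : pluckerForm P a (coordFun l) b c = 0 :=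
    pluckerForm_eq_zero_of_coordFun hP (fun i => hrot (h₂ c b i l)) a
  exact pluckerForm_eq_zero_of_coordFun hP (fun i => hrot (h₃ e b c i)) a

end SmoothFun

section DifferentialCochains

lemma map_mem_of_mem_span {R M N : Type*} [Semiring R] [AddCommMonoid M] [AddCommMonoid N]
    [Module R M] [Module R N] (T : M →ₗ[R] N) {s : Set M} {p : Submodule R N}
    (h : ∀ x ∈ s, T x ∈ p) {x : M} (hx : x ∈ Submodule.span R s) : T x ∈ p :=
  (Submodule.span_le (p := p.comap T)).2 h hx

variable {d : ℕ} {f g : SmoothFun d →ₗ[ℝ] SmoothFun d}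
  {F G P : SmoothFun d →ₗ[ℝ] SmoothFun d →ₗ[ℝ] SmoothFun d}

lemma iterPartial_cons (i : Fin d) (I : List (Fin d)) :
    iterPartial (i :: I) = partialDeriv i ∘ₗ iterPartial I := rfl

lemma mulLeft_comp_iterPartial_mem (a : SmoothFun d) (I : List (Fin d)) :
    LinearMap.mulLeft ℝ a ∘ₗ iterPartial I ∈ diffOneCochains d :=
  Submodule.subset_span ⟨a, I, rfl⟩

lemma iterPartial_mem (I : List (Fin d)) : iterPartial I ∈ diffOneCochains d := by
  simpa only [LinearMap.mulLeft_one, LinearMap.id_comp] using mulLeft_comp_iterPartial_mem 1 I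

lemma id_mem_diffOneCochains : LinearMap.id ∈ diffOneCochains d := iterPartial_mem []

lemma partialDeriv_mem (i : Fin d) : partialDeriv i ∈ diffOneCochains d := iterPartial_mem [i]

lemma cupProd_mem (hf : f ∈ diffOneCochains d) (hg : g ∈ diffOneCochains d) :
    cupProd f g ∈ diffTwoCochains d :=
  Submodule.subset_span ⟨f, hf, g, hg, rfl⟩

lemma mul_mem_diffTwoCochains : LinearMap.mul ℝ (SmoothFun d) ∈ diffTwoCochains d :=
  cupProd_mem id_mem_diffOneCochains id_mem_diffOneCochains

lemma mulLeft_comp_mem (φ : SmoothFun d) (hf : f ∈ diffOneCochains d) :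
    LinearMap.mulLeft ℝ φ ∘ₗ f ∈ diffOneCochains d := by
  refine map_mem_of_mem_span (LinearMap.compRight ℝ (LinearMap.mulLeft ℝ φ)) ?_ hf
  rintro _ ⟨a, I, rfl⟩
  rw [LinearMap.compRight_apply, ← LinearMap.comp_assoc, ← LinearMap.mulLeft_mul]
  exact mulLeft_comp_iterPartial_mem (φ * a) I

lemma partialDeriv_comp_mem (i : Fin d) (hf : f ∈ diffOneCochains d) :
    partialDeriv i ∘ₗ f ∈ diffOneCochains d := by
  refine map_mem_of_mem_span (LinearMap.compRight ℝ (partialDeriv i)) ?_ hf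
  rintro _ ⟨a, I, rfl⟩
  have hleibniz : partialDeriv i ∘ₗ LinearMap.mulLeft ℝ a ∘ₗ iterPartial I =
      LinearMap.mulLeft ℝ a ∘ₗ iterPartial (i :: I)
        + LinearMap.mulLeft ℝ (partialDeriv i a) ∘ₗ iterPartial I := by
    ext1 b
    simp [iterPartial_cons, partialDeriv_mul, mul_comm]
  rw [LinearMap.compRight_apply, hleibniz]
  exact add_mem (mulLeft_comp_iterPartial_mem _ _) (mulLeft_comp_iterPartial_mem _ _)

lemma iterPartial_comp_mem (I : List (Fin d)) (hf : f ∈ diffOneCochains d) :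
    iterPartial I ∘ₗ f ∈ diffOneCochains d := by
  induction I with
  | nil => exact hf
  | cons i I ih => exact partialDeriv_comp_mem i ih

lemma comp_mem_diffOneCochains (hf : f ∈ diffOneCochains d) (hg : g ∈ diffOneCochains d) :
    f ∘ₗ g ∈ diffOneCochains d := by
  refine map_mem_of_mem_span (LinearMap.lcomp ℝ _ g) ?_ hf
  rintro _ ⟨a, I, rfl⟩
  exact mulLeft_comp_mem a (iterPartial_comp_mem I hg)

lemma derivation_mem_diffOneCochains (δ : Derivation ℝ (SmoothFun d) (SmoothFun d)) :
    (δ : SmoothFun d →ₗ[ℝ] SmoothFun d) ∈ diffOneCochains d := by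
  have hδ : (δ : SmoothFun d →ₗ[ℝ] SmoothFun d) =
      ∑ i, LinearMap.mulLeft ℝ (δ (coordFun i)) ∘ₗ partialDeriv i := by
    ext1 f
    simp only [Derivation.coeFn_coe, LinearMap.sum_apply, LinearMap.comp_apply,
      LinearMap.mulLeft_apply, mul_comm (δ _), derivation_apply_eq_sum δ f,
      partialDerivation_apply]
  rw [hδ]
  exact Submodule.sum_mem _ fun i _ => mulLeft_comp_mem _ (partialDeriv_mem i)

lemma diffTwoCochains_sub_mem (hF : F ∈ diffTwoCochains d) (hG : G ∈ diffTwoCochains d) :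
    F - G ∈ diffTwoCochains d := by
  have hsub : F - G = F + (-1 : ℝ) • G := by
    ext1 a
    ext1 b
    simp [sub_eq_add_neg]
  rw [hsub]
  exact Submodule.add_mem _ hF (Submodule.smul_mem _ _ hG)

lemma apply_mem_diffOneCochains (hF : F ∈ diffTwoCochains d) (a : SmoothFun d) :
    F a ∈ diffOneCochains d := by
  refine map_mem_of_mem_span (LinearMap.applyₗ a) ?_ hF
  rintro _ ⟨f, _, g, hg, rfl⟩
  exact mulLeft_comp_mem (f a) hg

lemma flip_mem_diffTwoCochains (hF : F ∈ diffTwoCochains d) : F.flip ∈ diffTwoCochains d := by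
  refine map_mem_of_mem_span LinearMap.lflip.toLinearMap ?_ hF
  rintro _ ⟨f, hf, g, hg, rfl⟩
  have hflip : (cupProd f g).flip = cupProd g f := by
    ext1 a
    ext1 b
    exact mul_comm _ _
  change (cupProd f g).flip ∈ _
  rw [hflip]
  exact cupProd_mem hg hf

lemma compl₁₂_mem (hF : F ∈ diffTwoCochains d) (hf : f ∈ diffOneCochains d)
    (hg : g ∈ diffOneCochains d) : F.compl₁₂ f g ∈ diffTwoCochains d := by
  refine map_mem_of_mem_span
    (LinearMap.compRight ℝ (LinearMap.lcomp ℝ _ g) ∘ₗ LinearMap.lcomp ℝ _ f) ?_ hF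
  rintro _ ⟨f', hf', g', hg', rfl⟩
  exact cupProd_mem (comp_mem_diffOneCochains hf' hf) (comp_mem_diffOneCochains hg' hg)

lemma scaleCochain_mem (φ : SmoothFun d) (hF : F ∈ diffTwoCochains d) :
    scaleCochain φ F ∈ diffTwoCochains d := by
  refine map_mem_of_mem_span
    (LinearMap.compRight ℝ (LinearMap.compRight ℝ (LinearMap.mulLeft ℝ φ))) ?_ hF
  rintro _ ⟨f, hf, g, hg, rfl⟩
  have hscale : scaleCochain φ (cupProd f g) = cupProd (LinearMap.mulLeft ℝ φ ∘ₗ f) g := by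
    ext1 a
    ext1 b
    exact (mul_assoc _ _ _).symm
  change scaleCochain φ (cupProd f g) ∈ _
  rw [hscale]
  exact cupProd_mem (mulLeft_comp_mem φ hf) hg

lemma compr₂_partialDeriv_mem (i : Fin d) (hF : F ∈ diffTwoCochains d) :
    F.compr₂ (partialDeriv i) ∈ diffTwoCochains d := by
  refine map_mem_of_mem_span
    (LinearMap.compRight ℝ (LinearMap.compRight ℝ (partialDeriv i))) ?_ hF
  rintro _ ⟨f, hf, g, hg, rfl⟩
  have hleibniz : (cupProd f g).compr₂ (partialDeriv i) =
      cupProd f (partialDeriv i ∘ₗ g) + cupProd (partialDeriv i ∘ₗ f) g := by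
    ext1 a
    ext1 b
    simp [partialDeriv_mul, mul_comm]
  change (cupProd f g).compr₂ (partialDeriv i) ∈ _
  rw [hleibniz]
  exact add_mem (cupProd_mem hf (partialDeriv_comp_mem i hg))
    (cupProd_mem (partialDeriv_comp_mem i hf) hg)

lemma compr₂_iterPartial_mem (I : List (Fin d)) (hF : F ∈ diffTwoCochains d) :
    F.compr₂ (iterPartial I) ∈ diffTwoCochains d := by
  induction I with
  | nil => exact hF
  | cons i I ih => exact compr₂_partialDeriv_mem i ih

lemma compr₂_mem (hF : F ∈ diffTwoCochains d) (hf : f ∈ diffOneCochains d) :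
    F.compr₂ f ∈ diffTwoCochains d := by
  induction hf using Submodule.span_induction with
  | mem f h =>
    obtain ⟨c, I, rfl⟩ := h
    exact scaleCochain_mem c (compr₂_iterPartial_mem I hF)
  | zero => exact zero_mem _
  | add f g _ _ h₁ h₂ => exact add_mem h₁ h₂
  | smul r f _ h => exact Submodule.smul_mem _ r h

lemma coboundaryOne_mem (hf : f ∈ diffOneCochains d) : coboundaryOne f ∈ diffTwoCochains d :=
  add_mem (diffTwoCochains_sub_mem (cupProd_mem id_mem_diffOneCochains hf)
    (compr₂_mem mul_mem_diffTwoCochains hf)) (cupProd_mem hf id_mem_diffOneCochains)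

lemma gaugeCorrection_mem (hF : F ∈ diffTwoCochains d) (hf : f ∈ diffOneCochains d) :
    gaugeCorrection F f ∈ diffTwoCochains d := by
  have hid := id_mem_diffOneCochains (d := d)
  exact add_mem
    (diffTwoCochains_sub_mem
      (add_mem (add_mem (cupProd_mem hf hf) (compl₁₂_mem hF hf hid)) (compl₁₂_mem hF hid hf))
      (compr₂_mem (add_mem (add_mem (cupProd_mem hf hid) (cupProd_mem hid hf)) hF) hf))
    (compr₂_mem mul_mem_diffTwoCochains (comp_mem_diffOneCochains hf hf))

lemma skewPart_mem (hF : F ∈ diffTwoCochains d) : skewPart F ∈ diffTwoCochains d :=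
  Submodule.smul_mem _ _ (diffTwoCochains_sub_mem hF (flip_mem_diffTwoCochains hF))

lemma kontsevichTerm_mem {ι : Type*} [Fintype ι] (hP : IsPoisson P)
    (D : ι → Derivation ℝ (SmoothFun d) (SmoothFun d)) (x : ι → SmoothFun d) :
    kontsevichTerm hP D x ∈ diffTwoCochains d := by
  have hD := derivation_mem_diffOneCochains (d := d)
  refine Submodule.sum_mem _ fun i _ => Submodule.sum_mem _ fun j _ => add_mem (add_mem
    (Submodule.smul_mem _ _ ?_) (Submodule.smul_mem _ _ ?_)) ?_
  · exact cupProd_mem (comp_mem_diffOneCochains (hD _) (hD _))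
      (comp_mem_diffOneCochains (hD _) (hD _))
  · exact cupProd_mem (hD _) (comp_mem_diffOneCochains (hD _) (hD _))
  · exact cupProd_mem (comp_mem_diffOneCochains (hD _) (hD _)) (hD _)

end DifferentialCochains

section Doubling

lemma eq_zero_of_sum_pow_smul_eq_zero {K V : Type*} [Field K] [Infinite K] [AddCommGroup V]
    [Module K V] {s : Finset ℕ} {a : ℕ → V} (h : ∀ r : K, ∑ n ∈ s, r ^ n • a n = 0) {n : ℕ}
    (hn : n ∈ s) : a n = 0 := by
  refine (Module.forall_dual_apply_eq_zero_iff K _).1 fun ξ => ?_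
  have hpoly : ∑ m ∈ s, Polynomial.monomial m (ξ (a m)) = 0 := by
    refine Polynomial.funext fun r => ?_
    simpa [Polynomial.eval_finsetSum, mul_comm] using congrArg ξ (h r)
  simpa [Polynomial.finsetSum_coeff, Polynomial.coeff_monomial, hn] using
    congrArg (Polynomial.coeff · n) hpoly

/-- Symmetric 2-cocycles of an additive group, with values in a trivial module. -/
structure IsSymmCocycle {V M : Type*} [Add V] [AddCommGroup M] (s : V → V → M) : Prop where
  symm : ∀ u v, s u v = s v u
  cocycle : ∀ u v w, s v w - s (u + v) w + s u (v + w) - s u v = 0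

lemma IsSymmCocycle.apply_add_self {V M : Type*} [AddCommGroup V] [AddCommGroup M] {s : V → V → M}
    (hs : IsSymmCocycle s) (u v : V) :
    s (u + u) (v + v) + s u u + s v v = 2 • s u v + s (u + v) (u + v) := by
  have h₁ := hs.cocycle u u (v + v)
  have h₂ := hs.cocycle u v v
  have h₃ := hs.cocycle u v (u + v)
  rw [hs.symm v (u + v), add_left_comm v u v] at h₃
  linear_combination (norm := abel) h₂ + h₃ - h₁

variable {K V M : Type*} [Field K] [AddCommGroup V] [Module K V] [AddCommGroup M]
  [Module K M] {s : ℕ → V → V → M} {S : Finset ℕ}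

lemma IsSymmCocycle.eq_zero_of_additive {s : V → V → M} (hs : IsSymmCocycle s)
    (hadd : ∀ u v, s u v = s u 0 + s 0 v) (u v : V) : s u v = 0 := by
  have h₀ : s 0 0 = 0 := by simpa using hadd 0 0
  have hu := hs.cocycle u 0 0
  have hv := hs.cocycle 0 0 v
  simp only [add_zero, zero_add, h₀] at hu hv
  linear_combination (norm := abel) hadd u v - hu + hv

lemma IsSymmCocycle.two_sub_two_pow_smul {s : V → V → M} (hs : IsSymmCocycle s) {n : ℕ}
    (hdeg : ∀ (r : K) u v, s (r • u) (r • v) = r ^ n • s u v) (u v : V) :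
    (2 - 2 ^ n : K) • s u v = s u u - s (u + v) (u + v) + s v v := by
  have h := hs.apply_add_self u v
  rw [← two_smul K u, ← two_smul K v, hdeg, two_nsmul] at h
  rw [sub_smul, two_smul]
  linear_combination (norm := abel) -h

variable [CharZero K]

lemma IsSymmCocycle.of_sum (hs : IsSymmCocycle fun u v => ∑ n ∈ S, s n u v)
    (hdeg : ∀ n (r : K) u v, s n (r • u) (r • v) = r ^ n • s n u v) {n : ℕ} (hn : n ∈ S) :
    IsSymmCocycle (s n) := by
  refine ⟨fun u v => sub_eq_zero.1 ?_, fun u v w => ?_⟩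
  · refine eq_zero_of_sum_pow_smul_eq_zero (K := K) (a := fun n => s n u v - s n v u)
      (fun r => ?_) hn
    simp only [smul_sub, ← hdeg, Finset.sum_sub_distrib]
    exact sub_eq_zero.2 (hs.symm _ _)
  · refine eq_zero_of_sum_pow_smul_eq_zero (K := K)
      (a := fun n => s n v w - s n (u + v) w + s n u (v + w) - s n u v) (fun r => ?_) hn
    simp only [smul_sub, smul_add, ← hdeg, Finset.sum_sub_distrib, Finset.sum_add_distrib]
    exact hs.cocycle _ _ _

lemma two_sub_two_pow_ne_zero {n : ℕ} (hn : n ≠ 1) : (2 - 2 ^ n : K) ≠ 0 := by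
  rw [sub_ne_zero]
  intro h
  refine hn (Nat.pow_right_injective le_rfl ?_)
  exact_mod_cast (h.symm.trans (pow_one 2).symm : (2 : K) ^ n = 2 ^ 1)

lemma IsSymmCocycle.sum_eq (hs : IsSymmCocycle fun u v => ∑ n ∈ S, s n u v)
    (hdeg : ∀ n (r : K) u v, s n (r • u) (r • v) = r ^ n • s n u v)
    (hadd : ∀ u v, s 1 u v = s 1 u 0 + s 1 0 v) (u v : V) :
    ∑ n ∈ S, s n u v = ∑ n ∈ S, (2 - 2 ^ n : K)⁻¹ • s n u u
      - ∑ n ∈ S, (2 - 2 ^ n : K)⁻¹ • s n (u + v) (u + v)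
      + ∑ n ∈ S, (2 - 2 ^ n : K)⁻¹ • s n v v := by
  simp only [← Finset.sum_sub_distrib, ← Finset.sum_add_distrib, ← smul_sub, ← smul_add]
  refine Finset.sum_congr rfl fun n hn => ?_
  have hsn : IsSymmCocycle (s n) := hs.of_sum hdeg hn
  rw [← hsn.two_sub_two_pow_smul (hdeg n)]
  by_cases h : n = 1
  · subst h
    rw [hsn.eq_zero_of_additive hadd, smul_zero, smul_zero]
  · rw [inv_smul_smul₀ (two_sub_two_pow_ne_zero h)]

end Doubling

section Symbol

/-- The value, at a point with scalar coordinates, of a polynomial with coefficients in an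
algebra. The symbols of differential cochains are evaluated in this way. -/
noncomputable def scalarEval {k A σ : Type*} [CommSemiring k] [CommSemiring A] [Algebra k A]
    (u : σ → k) : MvPolynomial σ A →ₐ[A] A :=
  MvPolynomial.aeval fun i => algebraMap k A (u i)

section ScalarEval

variable {k A σ : Type*} [CommSemiring k] [CommSemiring A] [Algebra k A]

lemma scalarEval_X (u : σ → k) (i : σ) :
    scalarEval u (MvPolynomial.X i : MvPolynomial σ A) = algebraMap k A (u i) :=
  MvPolynomial.aeval_X _ i

lemma scalarEval_monomial (u : σ → k) (m : σ →₀ ℕ) (a : A) :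
    scalarEval u (MvPolynomial.monomial m a) = (m.prod fun i n => u i ^ n) • a := by
  rw [scalarEval, MvPolynomial.aeval_monomial, Algebra.algebraMap_self_apply, Algebra.smul_def,
    mul_comm, map_finsuppProd]
  simp only [map_pow]

lemma scalarEval_rename {τ : Type*} (u : τ → k) (f : σ → τ) (p : MvPolynomial σ A) :
    scalarEval u (MvPolynomial.rename f p) = scalarEval (u ∘ f) p :=
  MvPolynomial.aeval_rename _ _ _

lemma scalarEval_smul {p : MvPolynomial σ A} {n : ℕ} (hp : p.IsHomogeneous n) (r : k)
    (u : σ → k) : scalarEval (r • u) p = r ^ n • scalarEval u p := by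
  rw [p.as_sum, map_sum, map_sum, Finset.smul_sum]
  refine Finset.sum_congr rfl fun m hm => ?_
  have hdeg : ∑ i ∈ m.support, m i = n := by
    rw [← Finsupp.degree_apply, Finsupp.degree_eq_weight_one]
    exact hp (MvPolynomial.mem_support_iff.1 hm)
  simp only [scalarEval_monomial, smul_smul, Finsupp.prod, Pi.smul_apply, smul_eq_mul, mul_pow,
    Finset.prod_mul_distrib, Finset.prod_pow_eq_pow_sum, hdeg]

lemma scalarEval_add {p : MvPolynomial σ A} (hp : p.IsHomogeneous 1) (u v : σ → k) :
    scalarEval (u + v) p = scalarEval u p + scalarEval v p := by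
  replace hp : p ∈ Submodule.span A (Set.range MvPolynomial.X) := by
    rwa [← MvPolynomial.homogeneousSubmodule_one_eq_span_X, MvPolynomial.mem_homogeneousSubmodule]
  induction hp using Submodule.span_induction with
  | mem p h =>
    obtain ⟨i, rfl⟩ := h
    simp only [scalarEval_X, Pi.add_apply, map_add]
  | zero => simp only [map_zero, add_zero]
  | add p q _ _ hp hq => rw [map_add, map_add, map_add, hp, hq, add_add_add_comm]
  | smul a p _ hp => rw [map_smul, map_smul, map_smul, hp, smul_add]

end ScalarEval

variable {d : ℕ}

lemma eq_zero_of_scalarEval_eq_zero {σ : Type*} {p : MvPolynomial σ (SmoothFun d)}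
    (hp : ∀ u : σ → ℝ, scalarEval u p = 0) : p = 0 := by
  ext m x
  have hx : MvPolynomial.map (ContMDiffMap.evalRingHom x) p = 0 := by
    refine MvPolynomial.funext fun u => ?_
    have hu := congrArg (ContMDiffMap.evalRingHom x) (hp u)
    rw [scalarEval, MvPolynomial.map_aeval, map_zero] at hu
    rw [MvPolynomial.eval_map, map_zero]
    exact hu
  have hm := congrArg (MvPolynomial.coeff m) hx
  rwa [MvPolynomial.coeff_map] at hm

/-- The exponential `x ↦ exp (∑ u i * x i)`. These functions are joint eigenvectors of the
partial derivatives and therefore detect differential cochains. -/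
noncomputable def expFun (u : Fin d → ℝ) : SmoothFun d :=
  ⟨fun x => Real.exp (∑ i, u i * x i),
    (Real.contDiff_exp.comp (ContDiff.sum fun i _ => contDiff_const.mul
      (EuclideanSpace.proj (𝕜 := ℝ) i).contDiff)).contMDiff⟩

lemma expFun_add (u v : Fin d → ℝ) : expFun (u + v) = expFun u * expFun v := by
  ext x
  change Real.exp _ = Real.exp _ * Real.exp _
  rw [← Real.exp_add, ← Finset.sum_add_distrib]
  simp only [Pi.add_apply, add_mul]

lemma isUnit_expFun (u : Fin d → ℝ) : IsUnit (expFun u) := by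
  refine IsUnit.of_mul_eq_one (expFun (-u)) ?_
  rw [← expFun_add, add_neg_cancel]
  ext x
  change Real.exp _ = 1
  simp only [Pi.zero_apply, zero_mul, Finset.sum_const_zero, Real.exp_zero]

lemma partialDeriv_expFun (i : Fin d) (u : Fin d → ℝ) :
    partialDeriv i (expFun u) = u i • expFun u := by
  ext x
  have h : HasFDerivAt (fun x : EuclideanSpace ℝ (Fin d) => ∑ j, u j * x j)
      (∑ j, u j • EuclideanSpace.proj (𝕜 := ℝ) j) x :=
    HasFDerivAt.fun_sum fun j _ => (EuclideanSpace.proj (𝕜 := ℝ) j).hasFDerivAt.const_mul (u j)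
  change fderiv ℝ (fun x : EuclideanSpace ℝ (Fin d) => Real.exp (∑ j, u j * x j)) x _ =
    u i * Real.exp _
  rw [h.exp.fderiv]
  simp [mul_comm]

lemma iterPartial_expFun (I : List (Fin d)) (u : Fin d → ℝ) :
    iterPartial I (expFun u) = (I.map u).prod • expFun u := by
  induction I with
  | nil => exact (one_smul ℝ _).symm
  | cons i I ih =>
    rw [iterPartial_cons, LinearMap.comp_apply, ih, map_smul, partialDeriv_expFun, smul_smul,
      List.map_cons, List.prod_cons, mul_comm]

lemma iterPartial_perm {I J : List (Fin d)} (h : I.Perm J) : iterPartial I = iterPartial J := by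
  induction h with
  | nil => rfl
  | cons i _ ih => rw [iterPartial_cons, iterPartial_cons, ih]
  | swap i j I =>
    ext1 a
    exact partialDeriv_comm j i _
  | trans _ _ h₁ h₂ => exact h₁.trans h₂

/-- The differential operator with symbol `p`, with the coefficients to the left of the
derivatives. -/
noncomputable def diffOp :
    MvPolynomial (Fin d) (SmoothFun d) →ₗ[SmoothFun d] SmoothFun d →ₗ[ℝ] SmoothFun d :=
  (MvPolynomial.basisMonomials (Fin d) (SmoothFun d)).constr (SmoothFun d) fun m =>
    iterPartial m.toMultiset.toList

lemma diffOp_monomial (m : Fin d →₀ ℕ) (a : SmoothFun d) :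
    diffOp (MvPolynomial.monomial m a) =
      LinearMap.mulLeft ℝ a ∘ₗ iterPartial m.toMultiset.toList := by
  have hm : MvPolynomial.monomial m a = a • MvPolynomial.basisMonomials _ _ m := by
    rw [MvPolynomial.coe_basisMonomials, MvPolynomial.smul_monomial, smul_eq_mul, mul_one]
  rw [hm, map_smul, diffOp, Module.Basis.constr_basis]
  rfl

lemma diffOp_mem (p : MvPolynomial (Fin d) (SmoothFun d)) : diffOp p ∈ diffOneCochains d := by
  induction p using MvPolynomial.induction_on' with
  | monomial m a =>
    rw [diffOp_monomial]
    exact mulLeft_comp_iterPartial_mem a _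
  | add p q hp hq =>
    rw [map_add]
    exact add_mem hp hq

lemma diffOp_expFun (p : MvPolynomial (Fin d) (SmoothFun d)) (u : Fin d → ℝ) :
    diffOp p (expFun u) = scalarEval u p * expFun u := by
  induction p using MvPolynomial.induction_on' with
  | monomial m a =>
    have hprod : (m.toMultiset.toList.map u).prod = m.prod fun i n => u i ^ n := by
      rw [← Multiset.prod_coe, ← Multiset.map_coe, Multiset.coe_toList, Finsupp.toMultiset_map,
        Finsupp.prod_toMultiset, Finsupp.prod_mapDomain_index] <;> simp [pow_add]
    rw [diffOp_monomial, LinearMap.comp_apply, iterPartial_expFun, hprod, scalarEval_monomial,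
      LinearMap.mulLeft_apply, mul_smul_comm, smul_mul_assoc]
  | add p q hp hq => rw [map_add, map_add, LinearMap.add_apply, hp, hq, add_mul]

lemma exists_diffOp_eq {f : SmoothFun d →ₗ[ℝ] SmoothFun d} (hf : f ∈ diffOneCochains d) :
    ∃ p, diffOp p = f := by
  refine map_mem_of_mem_span (p := LinearMap.range (diffOp.restrictScalars ℝ)) LinearMap.id ?_ hf
  rintro _ ⟨a, I, rfl⟩
  refine ⟨MvPolynomial.monomial (Multiset.toFinsupp I) a, ?_⟩
  rw [LinearMap.restrictScalars_apply, diffOp_monomial, Multiset.toFinsupp_toMultiset]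
  exact congrArg _ (iterPartial_perm (Multiset.coe_eq_coe.1 (Multiset.coe_toList _)))

lemma eq_zero_of_apply_expFun {f : SmoothFun d →ₗ[ℝ] SmoothFun d} (hf : f ∈ diffOneCochains d)
    (h : ∀ u, f (expFun u) = 0) : f = 0 := by
  obtain ⟨p, rfl⟩ := exists_diffOp_eq hf
  have hp : p = 0 := eq_zero_of_scalarEval_eq_zero fun u =>
    (isUnit_expFun u).mul_left_eq_zero.1 ((diffOp_expFun p u).symm.trans (h u))
  rw [hp, map_zero]

variable {F G : SmoothFun d →ₗ[ℝ] SmoothFun d →ₗ[ℝ] SmoothFun d}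

lemma ext_expFun (hF : F ∈ diffTwoCochains d) (hG : G ∈ diffTwoCochains d)
    (h : ∀ u v, F (expFun u) (expFun v) = G (expFun u) (expFun v)) : F = G := by
  rw [← sub_eq_zero]
  have hFG : F - G ∈ diffTwoCochains d := diffTwoCochains_sub_mem hF hG
  have hu : ∀ u, (F - G) (expFun u) = 0 := fun u =>
    eq_zero_of_apply_expFun (apply_mem_diffOneCochains hFG _) fun v => sub_eq_zero.2 (h u v)
  ext1 a
  ext1 b
  exact LinearMap.congr_fun (eq_zero_of_apply_expFun
    (apply_mem_diffOneCochains (flip_mem_diffTwoCochains hFG) b)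
    fun u => LinearMap.congr_fun (hu u) b) a

lemma exists_symbol (hF : F ∈ diffTwoCochains d) :
    ∃ p : MvPolynomial (Fin d ⊕ Fin d) (SmoothFun d), ∀ u v,
      F (expFun u) (expFun v) = scalarEval (Sum.elim u v) p * expFun (u + v) := by
  induction hF using Submodule.span_induction with
  | mem F h =>
    obtain ⟨f, hf, g, hg, rfl⟩ := h
    obtain ⟨p, rfl⟩ := exists_diffOp_eq hf
    obtain ⟨q, rfl⟩ := exists_diffOp_eq hg
    refine ⟨MvPolynomial.rename Sum.inl p * MvPolynomial.rename Sum.inr q, fun u v => ?_⟩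
    rw [cupProd_apply, diffOp_expFun, diffOp_expFun, map_mul, scalarEval_rename,
      scalarEval_rename, Sum.elim_comp_inl, Sum.elim_comp_inr, expFun_add, mul_mul_mul_comm]
  | zero => exact ⟨0, fun u v => by rw [map_zero, zero_mul]; rfl⟩
  | add F G _ _ hF hG =>
    obtain ⟨p, hp⟩ := hF
    obtain ⟨q, hq⟩ := hG
    refine ⟨p + q, fun u v => ?_⟩
    rw [LinearMap.add_apply, LinearMap.add_apply, hp, hq, map_add, add_mul]
  | smul r F _ hF =>
    obtain ⟨p, hp⟩ := hF
    refine ⟨algebraMap ℝ (SmoothFun d) r • p, fun u v => ?_⟩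
    rw [LinearMap.smul_apply, LinearMap.smul_apply, hp, map_smul, smul_mul_assoc, algebraMap_smul]

lemma exists_homogeneous_symbols (hF : F ∈ diffTwoCochains d) :
    ∃ (S : Finset ℕ) (p : ℕ → MvPolynomial (Fin d ⊕ Fin d) (SmoothFun d)),
      (∀ n, (p n).IsHomogeneous n) ∧ ∀ u v, F (expFun u) (expFun v) =
        (∑ n ∈ S, scalarEval (Sum.elim u v) (p n)) * expFun (u + v) := by
  obtain ⟨p, hp⟩ := exists_symbol hF
  refine ⟨Finset.range (p.totalDegree + 1), fun n => MvPolynomial.homogeneousComponent n p,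
    fun n => MvPolynomial.homogeneousComponent_isHomogeneous n p, fun u v => ?_⟩
  rw [hp, ← map_sum, MvPolynomial.sum_homogeneousComponent]

lemma isSymmCocycle_symbol (hF : IsTwoCocycle F) (hsymm : ∀ a b, F a b = F b a)
    {s : (Fin d → ℝ) → (Fin d → ℝ) → SmoothFun d}
    (hs : ∀ u v, F (expFun u) (expFun v) = s u v * expFun (u + v)) : IsSymmCocycle s := by
  refine ⟨fun u v => (isUnit_expFun (u + v)).mul_right_cancel ?_, fun u v w =>
    (isUnit_expFun (u + v + w)).mul_left_eq_zero.1 ?_⟩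
  · rw [← hs, add_comm, ← hs, hsymm]
  · have h := hF (expFun u) (expFun v) (expFun w)
    simp only [coboundaryTwo, ← expFun_add, hs] at h
    simp only [expFun_add] at h ⊢
    linear_combination h

lemma exists_eq_coboundaryOne_of_symm (hF : F ∈ diffTwoCochains d) (hcocycle : IsTwoCocycle F)
    (hsymm : ∀ a b, F a b = F b a) : ∃ γ ∈ diffOneCochains d, F = coboundaryOne γ := by
  obtain ⟨S, p, hp, hsymbol⟩ := exists_homogeneous_symbols hF
  have hdeg (n : ℕ) (r : ℝ) (u v : Fin d → ℝ) : scalarEval (Sum.elim (r • u) (r • v)) (p n) =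
      r ^ n • scalarEval (Sum.elim u v) (p n) := by
    rw [← scalarEval_smul (hp n)]
    congr 2
    ext (i | i) <;> rfl
  have hadd (u v : Fin d → ℝ) : scalarEval (Sum.elim u v) (p 1) =
      scalarEval (Sum.elim u 0) (p 1) + scalarEval (Sum.elim 0 v) (p 1) := by
    rw [← scalarEval_add (hp 1), ← Sum.elim_add_add, add_zero, zero_add]
  let γ : SmoothFun d →ₗ[ℝ] SmoothFun d :=
    ∑ n ∈ S, (2 - 2 ^ n : ℝ)⁻¹ • diffOp (MvPolynomial.rename (Sum.elim id id) (p n))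
  have hγ : γ ∈ diffOneCochains d :=
    Submodule.sum_mem _ fun n _ => Submodule.smul_mem _ _ (diffOp_mem _)
  have hγ_exp (u : Fin d → ℝ) : γ (expFun u) =
      (∑ n ∈ S, (2 - 2 ^ n : ℝ)⁻¹ • scalarEval (Sum.elim u u) (p n)) * expFun u := by
    simp only [γ, LinearMap.sum_apply, LinearMap.smul_apply, diffOp_expFun, scalarEval_rename,
      Finset.sum_mul, smul_mul_assoc, Sum.comp_elim, Function.comp_id]
  refine ⟨γ, hγ, ext_expFun hF (coboundaryOne_mem hγ) fun u v => ?_⟩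
  rw [hsymbol, (isSymmCocycle_symbol hcocycle hsymm hsymbol).sum_eq hdeg hadd, coboundaryOne_apply,
    ← expFun_add, hγ_exp, hγ_exp, hγ_exp, expFun_add]
  ring

end Symbol

section Rescaling

variable {d : ℕ} {F : SmoothFun d →ₗ[ℝ] SmoothFun d →ₗ[ℝ] SmoothFun d}
  {γ : SmoothFun d →ₗ[ℝ] SmoothFun d}

lemma IsTwoCocycle.exists_eq_skewPart_add_coboundaryOne (hF : IsTwoCocycle F)
    (hF_mem : F ∈ diffTwoCochains d) :
    ∃ γ ∈ diffOneCochains d, F = skewPart F + coboundaryOne γ := by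
  have hsymm (a b : SmoothFun d) : (F - skewPart F) a b = (F - skewPart F) b a := by
    simp only [LinearMap.sub_apply]
    linear_combination -two_mul_skewPart_apply F a b + isSkew_skewPart F a b
  obtain ⟨γ, hγ, h⟩ := exists_eq_coboundaryOne_of_symm
    (diffTwoCochains_sub_mem hF_mem (skewPart_mem hF_mem))
    (hF.sub hF.isBiderivation_skewPart.isTwoCocycle) hsymm
  exact ⟨γ, hγ, by rw [← h]; exact (add_sub_cancel (skewPart F) F).symm⟩

lemma IsPoisson.diffPrimaryObstructionVanishes (hF : IsPoisson F) :
    DiffPrimaryObstructionVanishes F := by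
  refine ⟨(6⁻¹ : ℝ) • kontsevichTerm hF partialDerivation coordFun,
    Submodule.smul_mem _ _ (kontsevichTerm_mem hF _ _), fun a b c => ?_⟩
  have h := coboundaryTwo_kontsevichTerm hF (fun i j => partialDeriv_comm i j)
    hF.2.1.apply_eq_sum a b c
  rw [coboundaryTwo_smul, h, ← map_ofNat (algebraMap ℝ (SmoothFun d)), ← Algebra.smul_def,
    inv_smul_smul₀ (by norm_num)]

lemma DiffPrimaryObstructionVanishes.add_coboundaryOne (h : DiffPrimaryObstructionVanishes F)
    (hF_mem : F ∈ diffTwoCochains d) (hF : IsTwoCocycle F) (hγ : γ ∈ diffOneCochains d) :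
    DiffPrimaryObstructionVanishes (F + coboundaryOne γ) := by
  obtain ⟨G, hG_mem, hG⟩ := h
  exact ⟨G + gaugeCorrection F γ, add_mem hG_mem (gaugeCorrection_mem hF_mem hγ), fun a b c => by
    rw [compProd_add_coboundaryOne hF, hG, coboundaryTwo_add]⟩

lemma DiffPrimaryObstructionVanishes.primaryObstructionVanishes
    (h : DiffPrimaryObstructionVanishes F) : PrimaryObstructionVanishes F := by
  obtain ⟨G, -, hG⟩ := h
  exact ⟨G, hG⟩

lemma IsPoisson.scaleCochain (hd : d ≤ 3) (hF : IsPoisson F) (φ : SmoothFun d) :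
    IsPoisson (scaleCochain φ F) :=
  hF.scaleCochain_of_pluckerForm_eq_zero fun a b c =>
    pluckerForm_eq_zero_of_le_three hd hF.2.1 hF.1 a b c φ

lemma PrimaryObstructionVanishes.diffPrimaryObstructionVanishes_scaleCochain (hd : d ≤ 3)
    (h : PrimaryObstructionVanishes F) (hF_mem : F ∈ diffTwoCochains d) (hF : IsTwoCocycle F)
    (φ : SmoothFun d) : DiffPrimaryObstructionVanishes (scaleCochain φ F) := by
  obtain ⟨γ, hγ, hF_eq⟩ := hF.exists_eq_skewPart_add_coboundaryOne hF_mem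
  have hskew : PrimaryObstructionVanishes (skewPart F) := by
    have hF_sub : F - coboundaryOne γ = skewPart F := by
      conv_lhs => rw [hF_eq]
      exact add_sub_cancel_right (skewPart F) (coboundaryOne γ)
    exact hF_sub ▸ h.sub_coboundaryOne hF γ
  have hPoisson : IsPoisson (scaleCochain φ (skewPart F)) :=
    (hF.isBiderivation_skewPart.isPoisson (isSkew_skewPart F) hskew).scaleCochain hd φ
  rw [hF_eq, scaleCochain_add, scaleCochain_coboundaryOne]
  exact hPoisson.diffPrimaryObstructionVanishes.add_coboundaryOne
    (scaleCochain_mem φ (skewPart_mem hF_mem)) hPoisson.2.1.isTwoCocycle (mulLeft_comp_mem φ hγ)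

lemma IsInfinitesimalDeformation.scaleCochain (hF : IsInfinitesimalDeformation F)
    (φ : SmoothFun d) : IsInfinitesimalDeformation (scaleCochain φ F) := by
  obtain ⟨hF, γ, hγ⟩ := hF
  refine ⟨hF.scaleCochain φ, LinearMap.mulLeft ℝ φ ∘ₗ γ, ?_⟩
  rw [← scaleCochain_coboundaryOne, ← scaleCochain_sub]
  exact scaleCochain_mem φ hγ

lemma PrimaryObstructionVanishes.scaleCochain (hd : d ≤ 3) (h : PrimaryObstructionVanishes F)
    (hF : IsInfinitesimalDeformation F) (φ : SmoothFun d) :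
    PrimaryObstructionVanishes (scaleCochain φ F) := by
  obtain ⟨hF, γ, hγ⟩ := hF
  have hD : IsTwoCocycle (F - coboundaryOne γ) := hF.sub (isTwoCocycle_coboundaryOne γ)
  have hφD := ((h.sub_coboundaryOne hF γ).diffPrimaryObstructionVanishes_scaleCochain hd hγ hD
    φ).primaryObstructionVanishes
  have hφF := hφD.add_coboundaryOne (hD.scaleCochain φ) (LinearMap.mulLeft ℝ φ ∘ₗ γ)
  rw [← scaleCochain_coboundaryOne, ← scaleCochain_add] at hφF
  exact sub_add_cancel F (coboundaryOne γ) ▸ hφF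

end Rescaling

theorem theorem6_general {d : ℕ} (hd : d ≤ 3) (φ : SmoothFun d) :
    (∀ F : SmoothFun d →ₗ[ℝ] SmoothFun d →ₗ[ℝ] SmoothFun d,
      IsInfinitesimalDeformation F → PrimaryObstructionVanishes F →
        IsInfinitesimalDeformation (scaleCochain φ F) ∧
          PrimaryObstructionVanishes (scaleCochain φ F)) ∧
    (∀ F : SmoothFun d →ₗ[ℝ] SmoothFun d →ₗ[ℝ] SmoothFun d,
      F ∈ diffTwoCochains d → IsTwoCocycle F → PrimaryObstructionVanishes F →
        scaleCochain φ F ∈ diffTwoCochains d ∧ IsTwoCocycle (scaleCochain φ F) ∧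
          DiffPrimaryObstructionVanishes (scaleCochain φ F)) ∧
    (∀ F : SmoothFun d →ₗ[ℝ] SmoothFun d →ₗ[ℝ] SmoothFun d,
      IsPoisson F → IsPoisson (scaleCochain φ F)) :=
  ⟨fun _ hF h => ⟨hF.scaleCochain φ, h.scaleCochain hd hF φ⟩,
    fun _ hF_mem hF h => ⟨scaleCochain_mem φ hF_mem, hF.scaleCochain φ,
      h.diffPrimaryObstructionVanishes_scaleCochain hd hF_mem hF φ⟩,
    fun _ hF => IsPoisson.scaleCochain hd hF φ⟩

theorem theorem6 (φ : SmoothFun 3) :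
    (∀ F : SmoothFun 3 →ₗ[ℝ] SmoothFun 3 →ₗ[ℝ] SmoothFun 3,
      IsInfinitesimalDeformation F → PrimaryObstructionVanishes F →
        IsInfinitesimalDeformation (scaleCochain φ F) ∧
          PrimaryObstructionVanishes (scaleCochain φ F)) ∧
    (∀ F : SmoothFun 3 →ₗ[ℝ] SmoothFun 3 →ₗ[ℝ] SmoothFun 3,
      F ∈ diffTwoCochains 3 → IsTwoCocycle F → DiffPrimaryObstructionVanishes F →
        scaleCochain φ F ∈ diffTwoCochains 3 ∧ IsTwoCocycle (scaleCochain φ F) ∧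
          DiffPrimaryObstructionVanishes (scaleCochain φ F)) ∧
    (∀ F : SmoothFun 3 →ₗ[ℝ] SmoothFun 3 →ₗ[ℝ] SmoothFun 3,
      IsPoisson F → IsPoisson (scaleCochain φ F)) := by
  obtain ⟨hdeformation, hdifferential, hpoisson⟩ := theorem6_general le_rfl φ
  exact ⟨hdeformation, fun F hF_mem hF h => hdifferential F hF_mem hF h.primaryObstructionVanishes,
    hpoisson⟩
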